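/- Let $K$ be a field with $\operatorname{char} K\neq 2$ and let $X$ be a connected poset, i.e. for all $x,y\in X$ there are $n\geq 1$ and $x=x_0,x_1,\dots,x_n=y$ in $X$ such that $x_i\leq x_{i+1}$ or $x_{i+1}\leq x_i$ for $0\le i<n$. Let $I(X,K)$ be the space of functions $f:X\times X\to K$ with $f(x,y)=0$ whenever $x\nleq y$, and let $FI(X,K)$ be the finitary incidence algebra: the $K$-subspace of all $f\in I(X,K)$ such that for all $x\leq y$ in $X$ there are only finitely many subintervals $[u,v]\subseteq[x,y]$ with $u\neq v$ and $f(u,v)\neq 0$, with the product $(fg)(x,y)=\sum_{x\leq z\leq y}f(x,z)g(z,y)$. Automorphisms of $FI(X,K)$ are automorphisms of $K$-algebras. An automorphism is inner if it has the form $a\mapsto uau^{-1}$ for an invertible $u\in FI(X,K)$. It is multiplicative if it has the form $M_\sigma(f)(x,y)=\sigma(x,y)f(x,y)$, where $\sigma\in I(X,K)$ satisfies $\sigma(x,y)\neq 0$ for all $x\leq y$ and $\sigma(x,y)\sigma(y,z)=\sigma(x,z)$ for all $x\leq y\leq z$. An automorphism $\alpha$ of the poset $X$ induces the automorphism $\widehat\alpha$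 of $FI(X,K)$ given by $\widehat\alpha(f)(x,y)=f(\alpha^{-1}(x),\alpha^{-1}(y))$. Assume that every multiplicative automorphism of $FI(X,K)$ is inner. An involution on a $K$-algebra $A$ is an additive (not necessarily $K$-linear) map $\rho:A\to A$ with $\rho(ab)=\rho(b)\rho(a)$ and $\rho(\rho(a))=a$ for all $a,b\in A$; it is of the second kind if it is not the identity on the center of $A$. Two involutions $\rho_1,\rho_2$ on $A$ are equivalent if there is a $K$-algebra automorphism $\Phi$ of $A$ with $\Phi\circ\rho_1=\rho_2\circ\Phi$. Let $\rho_1$ and $\rho_2$ be involutions of the second kind on $FI(X,K)$. Then $\rho_1$ and $\rho_2$ are equivalent if and only if there exist an automorphism $\alpha$ of the poset $X$ and an inner automorphism $\Psi$ of $FI(X,K)$ such that $$\rho_1=\Psi\circ\widehat{\alpha}\circ\rho_2\circ\widehat{\alpha}^{-1}\circ\Psi^{-1}.$$ -/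

import Mathlib

/-- A poset is connected if any two elements are joined by a finite chain of (at least one)
steps between comparable elements. -/
def PosetConnected (X : Type*) [PartialOrder X] : Prop :=
  ∀ x y : X, Relation.TransGen (fun a b : X => a ≤ b ∨ b ≤ a) x y

section Involutions

/-- An involution on an algebra `A`: an additive anti-multiplicative map of order at most two.
It need not be linear over the base field. -/
structure IsInvolution {A : Type*} [Ring A] (ρ : A → A) : Prop where
  map_add : ∀ a b, ρ (a + b) = ρ a + ρ b
  map_mul : ∀ a b, ρ (a * b) = ρ b * ρ a
  involutive : ∀ a, ρ (ρ a) = a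

/-- An involution is of the second kind if it is not the identity on the center. -/
structure IsInvolutionSecondKind {A : Type*} [Ring A] (ρ : A → A) : Prop
    extends IsInvolution ρ where
  second_kind : ¬ ∀ a ∈ Subring.center A, ρ a = a

/-- Two involutions on a `K`-algebra are equivalent if some `K`-algebra automorphism `Φ`
satisfies `Φ ∘ ρ₁ = ρ₂ ∘ Φ`. -/
def InvolutionsEquivalent (K : Type*) {A : Type*} [Field K] [Ring A] [Algebra K A]
    (ρ₁ ρ₂ : A → A) : Prop :=
  ∃ Φ : A ≃ₐ[K] A, ⇑Φ ∘ ρ₁ = ρ₂ ∘ ⇑Φ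

/-- An automorphism is inner if it is conjugation by an invertible element. -/
def IsInnerAut {K A : Type*} [Field K] [Ring A] [Algebra K A] (Ψ : A ≃ₐ[K] A) : Prop :=
  ∃ u : Aˣ, ∀ a, Ψ a = u * a * (↑u⁻¹ : A)

end Involutions

section FinitaryIncidence

variable {K X : Type*} [Field K] [PartialOrder X]

/-- The nontrivial subintervals `[u, v]` of `[x, y]` on which `f` does not vanish, as pairs. -/
def finitarySupport (f : IncidenceAlgebra K X) (x y : X) : Set (X × X) :=
  {p | x ≤ p.1 ∧ p.1 ≤ p.2 ∧ p.2 ≤ y ∧ p.1 ≠ p.2 ∧ f p.1 p.2 ≠ 0}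

variable (K X) in
/-- The subspace of finitary functions in the incidence space. Mathlib's `IncidenceAlgebra K X`
is, as a vector space, the incidence space for every poset; it is a ring only in the locally
finite case, and that ring structure is not used. -/
def finitarySubmodule : Submodule K (IncidenceAlgebra K X) where
  carrier := {f | ∀ x y : X, x ≤ y → (finitarySupport f x y).Finite}
  zero_mem' := by
    intro x y _
    refine Set.Finite.subset Set.finite_empty ?_
    rintro p ⟨-, -, -, -, h⟩
    exact h rfl
  add_mem' := by
    intro f g hf hg x y hxy
    refine ((hf x y hxy).union (hg x y hxy)).subset ?_
    rintro p ⟨h1, h2, h3, h4, h5⟩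
    by_cases h : f p.1 p.2 = 0
    · refine Or.inr ⟨h1, h2, h3, h4, fun h' => h5 ?_⟩
      rw [IncidenceAlgebra.add_apply, h, h', add_zero]
    · exact Or.inl ⟨h1, h2, h3, h4, h⟩
  smul_mem' := by
    intro c f hf x y hxy
    refine (hf x y hxy).subset ?_
    rintro p ⟨h1, h2, h3, h4, h5⟩
    refine ⟨h1, h2, h3, h4, fun h' => h5 ?_⟩
    rw [IncidenceAlgebra.constSMul_apply, h', smul_zero]

variable (K X) in
/-- The finitary incidence algebra `FI(X, K)`. -/
def FI : Type _ := finitarySubmodule K X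

namespace FI

instance instAddCommGroup : AddCommGroup (FI K X) :=
  inferInstanceAs (AddCommGroup (finitarySubmodule K X))

instance instModule : Module K (FI K X) :=
  inferInstanceAs (Module K (finitarySubmodule K X))

instance instFunLike : FunLike (FI K X) X (X → K) where
  coe f := ⇑(f.1 : IncidenceAlgebra K X)
  coe_injective _ _ h := Subtype.ext (DFunLike.coe_injective h)

theorem ext {f g : FI K X} (h : ∀ x y : X, x ≤ y → f x y = g x y) : f = g :=
  Subtype.ext (IncidenceAlgebra.ext h)

theorem apply_eq_zero (f : FI K X) {x y : X} (h : ¬ x ≤ y) : f x y = 0 :=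
  IncidenceAlgebra.apply_eq_zero_of_not_le h _

theorem le_of_ne (f : FI K X) {x y : X} (h : f x y ≠ 0) : x ≤ y :=
  IncidenceAlgebra.le_of_ne_zero h

theorem add_apply (f g : FI K X) (x y : X) : (f + g) x y = f x y + g x y := rfl

theorem zero_apply (x y : X) : (0 : FI K X) x y = 0 := rfl

theorem smul_apply (c : K) (f : FI K X) (x y : X) : (c • f) x y = c * f x y := rfl

/-- A finite set containing every `z ≤ y` with `f x z ≠ 0`. -/
theorem exists_finset_left (f : FI K X) {x y : X} (hxy : x ≤ y) :
    ∃ T : Finset X, (∀ z ∈ T, x ≤ z ∧ z ≤ y) ∧ ∀ z, z ≤ y → f x z ≠ 0 → z ∈ T := by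
  classical
  refine ⟨insert x ((f.2 x y hxy).toFinset.image Prod.snd), ?_, ?_⟩
  · intro z hz
    simp only [Finset.mem_insert, Finset.mem_image, Set.Finite.mem_toFinset] at hz
    rcases hz with rfl | ⟨p, ⟨h1, h2, h3, -, -⟩, rfl⟩
    · exact ⟨le_rfl, hxy⟩
    · exact ⟨h1.trans h2, h3⟩
  · intro z hzy hz
    simp only [Finset.mem_insert, Finset.mem_image, Set.Finite.mem_toFinset]
    by_cases h : z = x
    · exact Or.inl h
    · exact Or.inr ⟨(x, z), ⟨le_rfl, f.le_of_ne hz, hzy, fun h' => h h'.symm, hz⟩, rfl⟩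

/-- A finite set containing every `z ≥ x` with `f z y ≠ 0`. -/
theorem exists_finset_right (f : FI K X) {x y : X} (hxy : x ≤ y) :
    ∃ T : Finset X, (∀ z ∈ T, x ≤ z ∧ z ≤ y) ∧ ∀ z, x ≤ z → f z y ≠ 0 → z ∈ T := by
  classical
  refine ⟨insert y ((f.2 x y hxy).toFinset.image Prod.fst), ?_, ?_⟩
  · intro z hz
    simp only [Finset.mem_insert, Finset.mem_image, Set.Finite.mem_toFinset] at hz
    rcases hz with rfl | ⟨p, ⟨h1, h2, h3, -, -⟩, rfl⟩
    · exact ⟨hxy, le_rfl⟩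
    · exact ⟨h1, h2.trans h3⟩
  · intro z hxz hz
    simp only [Finset.mem_insert, Finset.mem_image, Set.Finite.mem_toFinset]
    by_cases h : z = y
    · exact Or.inl h
    · exact Or.inr ⟨(z, y), ⟨hxz, f.le_of_ne hz, le_rfl, h, hz⟩, rfl⟩

/-- Convolution. Only the `z` with `x ≤ z ≤ y` contribute, and only finitely many of the terms
are nonzero (`mul_support_finite`), so the `finsum` is the actual sum. -/
noncomputable instance instMul : Mul (FI K X) where
  mul f g :=
    ⟨⟨fun x y => ∑ᶠ z ∈ Set.Icc x y, f x z * g z y, by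
        intro x y h
        simp [Set.Icc_eq_empty h]⟩, by
      intro x y hxy
      refine (((f.2 x y hxy).union (g.2 x y hxy)).union
        (((f.2 x y hxy).image Prod.fst).prod ((g.2 x y hxy).image Prod.snd))).subset ?_
      rintro ⟨u, v⟩ ⟨h1, h2, h3, h4, h5⟩
      obtain ⟨z, hz⟩ : ∃ z, f u z * g z v ≠ 0 := by
        by_contra! hcon
        apply h5
        change ∑ᶠ z ∈ Set.Icc u v, f u z * g z v = 0
        simp [hcon]
      have hf : f u z ≠ 0 := left_ne_zero_of_mul hz
      have hg : g z v ≠ 0 := right_ne_zero_of_mul hz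
      have huz := f.le_of_ne hf
      have hzv := g.le_of_ne hg
      by_cases e1 : u = z
      · subst e1
        exact Or.inl (Or.inr ⟨h1, h2, h3, h4, hg⟩)
      by_cases e2 : z = v
      · subst e2
        exact Or.inl (Or.inl ⟨h1, h2, h3, h4, hf⟩)
      · exact Or.inr ⟨⟨(u, z), ⟨h1, huz, hzv.trans h3, e1, hf⟩, rfl⟩,
          ⟨(z, v), ⟨h1.trans huz, hzv, h3, e2, hg⟩, rfl⟩⟩⟩

theorem mul_apply (f g : FI K X) (x y : X) :
    (f * g) x y = ∑ᶠ z ∈ Set.Icc x y, f x z * g z y := rfl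

theorem mul_apply' (f g : FI K X) (x y : X) :
    (f * g) x y = ∑ᶠ z, f x z * g z y := by
  rw [mul_apply]
  refine finsum_congr fun z => ?_
  by_cases hz : z ∈ Set.Icc x y
  · simp [hz]
  · have : f x z * g z y = 0 := by
      by_contra h
      exact hz ⟨f.le_of_ne (left_ne_zero_of_mul h), g.le_of_ne (right_ne_zero_of_mul h)⟩
    simp [this]

theorem mul_support_finite (f g : FI K X) (x y : X) :
    (Function.support fun z => f x z * g z y).Finite := by
  by_cases hxy : x ≤ y
  · obtain ⟨T, -, hT⟩ := f.exists_finset_left hxy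
    exact T.finite_toSet.subset fun z hz =>
      hT z (g.le_of_ne (right_ne_zero_of_mul hz)) (left_ne_zero_of_mul hz)
  · refine Set.finite_empty.subset fun z hz => hxy ?_
    exact (f.le_of_ne (left_ne_zero_of_mul hz)).trans (g.le_of_ne (right_ne_zero_of_mul hz))

theorem mul_apply_eq_sum (f g : FI K X) (x y : X) (T : Finset X)
    (hT : ∀ z, f x z ≠ 0 → g z y ≠ 0 → z ∈ T) :
    (f * g) x y = ∑ z ∈ T, f x z * g z y := by
  rw [mul_apply']
  refine finsum_eq_sum_of_support_subset _ fun z hz => ?_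
  exact hT z (left_ne_zero_of_mul hz) (right_ne_zero_of_mul hz)

open Classical in
/-- The unity `δ`. -/
noncomputable instance instOne : One (FI K X) where
  one :=
    ⟨⟨fun x y => if x = y then 1 else 0, fun _ _ h => if_neg fun e => h e.le⟩, by
      intro x y _
      refine Set.finite_empty.subset ?_
      rintro p ⟨-, -, -, h, h'⟩
      exact h' (if_neg h)⟩

open Classical in
theorem one_apply (x y : X) : (1 : FI K X) x y = if x = y then 1 else 0 := rfl

noncomputable instance instRing : Ring (FI K X) :=
  { FI.instAddCommGroup, FI.instMul, FI.instOne with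
    left_distrib := by
      intro f g h
      refine ext fun x y _ => ?_
      rw [add_apply, mul_apply', mul_apply', mul_apply',
        ← finsum_add_distrib (mul_support_finite f g x y) (mul_support_finite f h x y)]
      exact finsum_congr fun z => by rw [add_apply, mul_add]
    right_distrib := by
      intro f g h
      refine ext fun x y _ => ?_
      rw [add_apply, mul_apply', mul_apply', mul_apply',
        ← finsum_add_distrib (mul_support_finite f h x y) (mul_support_finite g h x y)]
      exact finsum_congr fun z => by rw [add_apply, add_mul]
    zero_mul := by
      intro f
      refine ext fun x y _ => ?_
      rw [mul_apply', zero_apply]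
      simp [zero_apply]
    mul_zero := by
      intro f
      refine ext fun x y _ => ?_
      rw [mul_apply', zero_apply]
      simp [zero_apply]
    one_mul := by
      intro f
      refine ext fun x y _ => ?_
      rw [mul_apply_eq_sum _ _ _ _ {x} (by
        intro z hz _
        by_contra h
        exact hz (if_neg fun e => h (by simp [e])))]
      simp [one_apply]
    mul_one := by
      intro f
      refine ext fun x y _ => ?_
      rw [mul_apply_eq_sum _ _ _ _ {y} (by
        intro z _ hz
        by_contra h
        exact hz (if_neg fun e => h (by simp [e])))]
      simp [one_apply]
    mul_assoc := by
      intro f g h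
      refine ext fun x y hxy => ?_
      obtain ⟨S, hS, hS'⟩ := f.exists_finset_left hxy
      obtain ⟨T, hT, hT'⟩ := h.exists_finset_right hxy
      rw [mul_apply_eq_sum (f * g) h x y T fun w hw hw' => hT' w (le_of_ne _ hw) hw',
        mul_apply_eq_sum f (g * h) x y S fun z hz hz' => hS' z (le_of_ne _ hz') hz]
      have e1 : ∀ w ∈ T, (f * g) x w * h w y = ∑ z ∈ S, f x z * (g z w * h w y) := by
        intro w hw
        rw [mul_apply_eq_sum f g x w S fun z hz hz' =>
          hS' z ((g.le_of_ne hz').trans (hT w hw).2) hz, Finset.sum_mul]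
        exact Finset.sum_congr rfl fun z _ => mul_assoc _ _ _
      have e2 : ∀ z ∈ S, f x z * (g * h) z y = ∑ w ∈ T, f x z * (g z w * h w y) := by
        intro z hz
        rw [mul_apply_eq_sum g h z y T fun w hw hw' =>
          hT' w ((hS z hz).1.trans (g.le_of_ne hw)) hw', Finset.mul_sum]
      rw [Finset.sum_congr rfl e1, Finset.sum_congr rfl e2, Finset.sum_comm]
    neg_add_cancel := neg_add_cancel }

noncomputable instance instAlgebra : Algebra K (FI K X) :=
  Algebra.ofModule
    (by
      intro c f g
      refine ext fun x y _ => ?_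
      rw [smul_apply, mul_apply', mul_apply', mul_finsum' _ _ (mul_support_finite f g x y)]
      exact finsum_congr fun z => by rw [smul_apply, mul_assoc])
    (by
      intro c f g
      refine ext fun x y _ => ?_
      rw [smul_apply, mul_apply', mul_apply', mul_finsum' _ _ (mul_support_finite f g x y)]
      exact finsum_congr fun z => by rw [smul_apply, mul_left_comm])

/-- The function `(x, y) ↦ f(α⁻¹ x, α⁻¹ y)`. -/
noncomputable def mapFun (α : X ≃o X) (f : FI K X) : FI K X :=
  ⟨⟨fun x y => f (α.symm x) (α.symm y), fun x y h =>
      f.apply_eq_zero fun h' => h (α.symm.le_iff_le.1 h')⟩, by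
    intro x y hxy
    refine ((f.2 (α.symm x) (α.symm y) (α.symm.monotone hxy)).image (Prod.map α α)).subset ?_
    rintro ⟨u, v⟩ ⟨h1, h2, h3, h4, h5⟩
    exact ⟨(α.symm u, α.symm v), ⟨α.symm.monotone h1, α.symm.monotone h2, α.symm.monotone h3,
      fun e => h4 (α.symm.injective e), h5⟩, by simp⟩⟩

theorem mapFun_apply (α : X ≃o X) (f : FI K X) (x y : X) :
    mapFun α f x y = f (α.symm x) (α.symm y) := rfl

/-- The automorphism `α̂` of `FI(X, K)` induced by an automorphism `α` of the poset `X`. -/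
noncomputable def hat (α : X ≃o X) : FI K X ≃ₐ[K] FI K X :=
  AlgEquiv.ofLinearEquiv
    { toFun := mapFun α
      map_add' := fun _ _ => rfl
      map_smul' := fun _ _ => rfl
      invFun := mapFun α.symm
      left_inv := fun f => ext fun x y _ => by simp [mapFun_apply]
      right_inv := fun f => ext fun x y _ => by simp [mapFun_apply] }
    (by
      refine ext fun x y _ => ?_
      change mapFun α 1 x y = _
      rw [mapFun_apply, one_apply, one_apply]
      by_cases e : x = y
      · rw [if_pos e, if_pos (congrArg _ e)]
      · rw [if_neg e, if_neg fun e' => e (α.symm.injective e')])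
    (by
      intro f g
      refine ext fun x y _ => ?_
      change mapFun α (f * g) x y = (mapFun α f * mapFun α g) x y
      rw [mapFun_apply, mul_apply', mul_apply']
      exact (finsum_comp_equiv (f := fun z => f (α.symm x) z * g z (α.symm y))
        α.symm.toEquiv).symm)

theorem hat_apply (α : X ≃o X) (f : FI K X) (x y : X) :
    hat α f x y = f (α.symm x) (α.symm y) := rfl

/-- Multiplicative elements of the incidence space. -/
structure IsMultiplicativeElement (σ : IncidenceAlgebra K X) : Prop where
  ne_zero : ∀ x y : X, x ≤ y → σ x y ≠ 0
  mul_eq : ∀ x y z : X, x ≤ y → y ≤ z → σ x y * σ y z = σ x z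

/-- The entrywise product of a function `s` with `f`. -/
noncomputable def scaleFun (s : X → X → K) (f : FI K X) : FI K X :=
  ⟨⟨fun x y => s x y * f x y, fun x y h => by rw [f.apply_eq_zero h, mul_zero]⟩, by
    intro x y hxy
    refine (f.2 x y hxy).subset ?_
    rintro p ⟨h1, h2, h3, h4, h5⟩
    exact ⟨h1, h2, h3, h4, right_ne_zero_of_mul h5⟩⟩

theorem scaleFun_apply (s : X → X → K) (f : FI K X) (x y : X) :
    scaleFun s f x y = s x y * f x y := rfl

/-- The multiplicative automorphism `M_σ`, `M_σ(f)(x, y) = σ(x, y) f(x, y)`. -/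
noncomputable def multAut (σ : IncidenceAlgebra K X) (hσ : IsMultiplicativeElement σ) :
    FI K X ≃ₐ[K] FI K X :=
  AlgEquiv.ofLinearEquiv
    { toFun := scaleFun σ
      map_add' := fun f g => ext fun x y _ => by
        rw [scaleFun_apply, add_apply, add_apply, scaleFun_apply, scaleFun_apply, mul_add]
      map_smul' := fun c f => ext fun x y _ => by
        rw [RingHom.id_apply, scaleFun_apply, smul_apply, smul_apply, scaleFun_apply,
          mul_left_comm]
      invFun := scaleFun fun x y => (σ x y)⁻¹
      left_inv := fun f => ext fun x y h => by
        rw [scaleFun_apply, scaleFun_apply, inv_mul_cancel_left₀ (hσ.ne_zero x y h)]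
      right_inv := fun f => ext fun x y h => by
        rw [scaleFun_apply, scaleFun_apply, mul_inv_cancel_left₀ (hσ.ne_zero x y h)] }
    (by
      refine ext fun x y _ => ?_
      change scaleFun σ 1 x y = _
      rw [scaleFun_apply, one_apply]
      split_ifs with e
      · subst e
        have h1 := hσ.mul_eq x x x le_rfl le_rfl
        have h2 := hσ.ne_zero x x le_rfl
        rw [mul_one]
        exact mul_left_cancel₀ h2 (by rw [h1, mul_one])
      · exact mul_zero _)
    (by
      intro f g
      refine ext fun x y _ => ?_
      change scaleFun σ (f * g) x y = (scaleFun σ f * scaleFun σ g) x y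
      rw [scaleFun_apply, mul_apply', mul_apply', mul_finsum' _ _ (mul_support_finite f g x y)]
      refine finsum_congr fun z => ?_
      rw [scaleFun_apply, scaleFun_apply]
      by_cases hf : f x z = 0
      · simp [hf]
      by_cases hg : g z y = 0
      · simp [hg]
      rw [← hσ.mul_eq x z y (f.le_of_ne hf) (g.le_of_ne hg)]
      ring)

theorem multAut_apply (σ : IncidenceAlgebra K X) (hσ : IsMultiplicativeElement σ)
    (f : FI K X) (x y : X) : multAut σ hσ f x y = σ x y * f x y := rfl

/-- An automorphism of `FI(X, K)` is multiplicative if it is `M_σ` for some multiplicative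
element `σ` of the incidence space. -/
def IsMultiplicativeAut (M : FI K X ≃ₐ[K] FI K X) : Prop :=
  ∃ (σ : IncidenceAlgebra K X) (hσ : IsMultiplicativeElement σ), M = multAut σ hσ

end FI

end FinitaryIncidence

/-! ### Diagonal idempotents and matrix units -/

namespace FI

variable {K X : Type*} [Field K] [PartialOrder X]

/-! Equivalence means ρ₁ = Φ⁻¹ ∘ ρ₂ ∘ Φ for an algebra automorphism Φ, so everything rests on
`exists_inner_multAut_hat`: each automorphism is an inner one after a multiplicative one after some
α̂. Multiplicative automorphisms being inner by assumption, Φ⁻¹ = Ψ ∘ α̂ with Ψ inner, which is the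
required formula. Conversely, Φ = (Ψ ∘ α̂)⁻¹ is an equivalence.

The decomposition follows the idempotents e_x = `idem K {x}`. Elements with zero diagonal are
nilpotent on every interval, so an idempotent with zero diagonal vanishes. Hence E_x = Φ(e_x) has a
nonzero diagonal entry, which yields a bijection α of X with Φ(f)(αx, αx) = f(x, x)
(`exists_equiv_aut_apply`).

Let v be the matrix whose row αx is that row of E_x. Its diagonal is 1, so it is invertible, and
orthogonality of the E_x gives v E_x = e_{αx} v (`exists_unit_conj_idem`). The delicate point is
that v is finitary, although its rows come from infinitely many elements (`finite_column_tails`,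
`finite_row_support`).

After conjugation by v, Φ permutes the e_x. It then sends matrix units to nonzero multiples of
matrix units, so α is an order automorphism and the scalars form a multiplicative element
(`exists_multAut_hat`). -/

theorem mul_apply_self (f g : FI K X) (x : X) : (f * g) x x = f x x * g x x := by
  rw [mul_apply_eq_sum f g x x {x} fun z hz hz' => by
    rw [Finset.mem_singleton]
    exact le_antisymm (g.le_of_ne hz') (f.le_of_ne hz)]
  simp

theorem sub_apply (f g : FI K X) (x y : X) : (f - g) x y = f x y - g x y := by
  rw [eq_sub_iff_add_eq, ← add_apply, sub_add_cancel]

theorem sum_apply {ι : Type*} (s : Finset ι) (f : ι → FI K X) (x y : X) :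
    (∑ i ∈ s, f i) x y = ∑ i ∈ s, f i x y := by
  classical
  induction s using Finset.induction_on with
  | empty => simp [zero_apply]
  | insert a s ha ih => rw [Finset.sum_insert ha, Finset.sum_insert ha, add_apply, ih]

open Classical in
/-- The diagonal element with entries `d`. -/
noncomputable def diag (d : X → K) : FI K X :=
  ⟨⟨fun x y => if x = y then d x else 0, fun _ _ h => if_neg fun e => h e.le⟩, by
    intro x y _
    refine Set.finite_empty.subset ?_
    rintro p ⟨-, -, -, h, h'⟩
    exact h' (if_neg h)⟩

theorem diag_apply_self (d : X → K) (x : X) : diag d x x = d x := if_pos rfl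

theorem diag_apply_ne (d : X → K) {x y : X} (h : x ≠ y) : diag d x y = 0 := if_neg h

theorem diag_mul_apply (d : X → K) (f : FI K X) (x y : X) :
    (diag d * f) x y = d x * f x y := by
  rw [mul_apply_eq_sum _ f x y {x} fun z hz _ => by
    rw [Finset.mem_singleton]
    by_contra h
    exact hz (diag_apply_ne d (Ne.symm h))]
  rw [Finset.sum_singleton, diag_apply_self]

theorem mul_diag_apply (d : X → K) (f : FI K X) (x y : X) :
    (f * diag d) x y = f x y * d y := by
  rw [mul_apply_eq_sum f _ x y {y} fun z _ hz => by
    rw [Finset.mem_singleton]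
    by_contra h
    exact hz (diag_apply_ne d h)]
  rw [Finset.sum_singleton, diag_apply_self]

theorem diag_mul_diag (d e : X → K) : diag d * diag e = diag fun x => d x * e x := by
  refine ext fun x y _ => ?_
  rw [diag_mul_apply]
  by_cases h : x = y
  · subst h
    rw [diag_apply_self, diag_apply_self]
  · rw [diag_apply_ne _ h, diag_apply_ne _ h, mul_zero]

open Classical in
variable (K) in
/-- The diagonal idempotent of a subset. -/
noncomputable def idem (S : Set X) : FI K X := diag fun x => if x ∈ S then 1 else 0

theorem idem_apply_of_mem {S : Set X} {x : X} (h : x ∈ S) : idem K S x x = 1 := by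
  rw [idem, diag_apply_self, if_pos h]

theorem idem_apply_of_notMem {S : Set X} {x : X} (h : x ∉ S) : idem K S x x = 0 := by
  rw [idem, diag_apply_self, if_neg h]

theorem idem_mul_idem (S T : Set X) : idem K S * idem K T = idem K (S ∩ T) := by
  classical
  rw [idem, idem, idem, diag_mul_diag]
  congr 1
  funext x
  by_cases h : x ∈ S <;> by_cases h' : x ∈ T <;> simp [h, h']

theorem idem_empty : idem K (∅ : Set X) = 0 := by
  refine ext fun x y _ => ?_
  by_cases h : x = y
  · subst h
    exact idem_apply_of_notMem (Set.notMem_empty x)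
  · exact diag_apply_ne _ h

theorem idem_mul_apply_self (x y : X) (f : FI K X) : (idem K {x} * f) x y = f x y := by
  rw [idem, diag_mul_apply, if_pos (Set.mem_singleton x), one_mul]

theorem mul_idem_apply_self (x y : X) (f : FI K X) : (f * idem K {y}) x y = f x y := by
  rw [idem, mul_diag_apply, if_pos (Set.mem_singleton y), mul_one]

theorem idem_mul_apply_ne {a x : X} (h : a ≠ x) (y : X) (f : FI K X) :
    (idem K {x} * f) a y = 0 := by
  rw [idem, diag_mul_apply, if_neg (by simpa using h), zero_mul]

theorem mul_idem_apply_ne {b y : X} (h : b ≠ y) (x : X) (f : FI K X) :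
    (f * idem K {y}) x b = 0 := by
  rw [idem, mul_diag_apply, if_neg (by simpa using h), mul_zero]

open Classical in
variable (K) in
/-- The matrix unit at `(x, y)`, for `x ≤ y`. -/
noncomputable def matrixUnit {x y : X} (hxy : x ≤ y) : FI K X :=
  ⟨⟨fun a b => if a = x ∧ b = y then 1 else 0,
    fun a b h => if_neg fun e => h (by rw [e.1, e.2]; exact hxy)⟩, by
    intro p q _
    refine (Set.finite_singleton (x, y)).subset ?_
    rintro ⟨a, b⟩ ⟨-, -, -, -, h⟩
    by_contra h'
    exact h (if_neg fun e => h' (Prod.ext e.1 e.2))⟩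

theorem matrixUnit_apply_self {x y : X} (hxy : x ≤ y) : matrixUnit K hxy x y = 1 :=
  if_pos ⟨rfl, rfl⟩

theorem matrixUnit_apply_ne {x y : X} (hxy : x ≤ y) {a b : X} (h : ¬ (a = x ∧ b = y)) :
    matrixUnit K hxy a b = 0 := if_neg h

theorem idem_mul_mul_idem {x y : X} (hxy : x ≤ y) (f : FI K X) :
    idem K {x} * f * idem K {y} = f x y • matrixUnit K hxy := by
  refine ext fun a b _ => ?_
  rw [smul_apply]
  by_cases hb : b = y
  · subst hb
    rw [mul_idem_apply_self]
    by_cases ha : a = x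
    · subst ha
      rw [idem_mul_apply_self, matrixUnit_apply_self, mul_one]
    · rw [idem_mul_apply_ne ha, matrixUnit_apply_ne hxy fun h => ha h.1, mul_zero]
  · rw [mul_idem_apply_ne hb, matrixUnit_apply_ne hxy fun h => hb h.2, mul_zero]

theorem idem_mul_mul_idem_of_not_le {x y : X} (hxy : ¬ x ≤ y) (f : FI K X) :
    idem K {x} * f * idem K {y} = 0 := by
  refine ext fun a b _ => ?_
  rw [zero_apply]
  by_cases hb : b = y
  · subst hb
    rw [mul_idem_apply_self]
    by_cases ha : a = x
    · subst ha
      rw [idem_mul_apply_self, f.apply_eq_zero hxy]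
    · rw [idem_mul_apply_ne ha]
  · rw [mul_idem_apply_ne hb]

theorem matrixUnit_self (x : X) : matrixUnit K (le_refl x) = idem K {x} := by
  have h := idem_mul_mul_idem (le_refl x) (1 : FI K X)
  rw [mul_one, idem_mul_idem, Set.inter_self, one_apply, if_pos rfl, one_smul] at h
  exact h.symm

theorem matrixUnit_mul {x y z : X} (hxy : x ≤ y) (hyz : y ≤ z) :
    matrixUnit K hxy * matrixUnit K hyz = matrixUnit K (hxy.trans hyz) := by
  refine ext fun a b _ => ?_
  rw [mul_apply_eq_sum _ _ a b {y} fun w hw _ => by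
    rw [Finset.mem_singleton]
    by_contra h
    exact hw (matrixUnit_apply_ne hxy fun e => h e.2), Finset.sum_singleton]
  by_cases ha : a = x
  · by_cases hb : b = z
    · subst ha hb
      simp only [matrixUnit_apply_self, mul_one]
    · rw [matrixUnit_apply_ne hyz fun e => hb e.2,
        matrixUnit_apply_ne (hxy.trans hyz) fun e => hb e.2, mul_zero]
  · rw [matrixUnit_apply_ne hxy fun e => ha e.1,
      matrixUnit_apply_ne (hxy.trans hyz) fun e => ha e.1, zero_mul]

/-! ### Local nilpotency and invertibility -/

theorem exists_ne_zero_of_mul_apply_ne_zero {f g : FI K X} {x y : X} (h : (f * g) x y ≠ 0) :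
    ∃ z, f x z ≠ 0 ∧ g z y ≠ 0 := by
  by_contra! hcon
  refine h ?_
  rw [mul_apply_eq_sum f g x y ∅ fun z hz hz' => absurd (hcon z hz) hz', Finset.sum_empty]

theorem mul_apply_congr {f f' g g' : FI K X} {x y : X}
    (hf : ∀ z, x ≤ z → z ≤ y → f x z = f' x z) (hg : ∀ z, x ≤ z → z ≤ y → g z y = g' z y) :
    (f * g) x y = (f' * g') x y := by
  rw [mul_apply, mul_apply]
  refine finsum_congr fun z => ?_
  refine finsum_congr fun hz => ?_
  rw [hf z hz.1 hz.2, hg z hz.1 hz.2]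

/-- An element with zero diagonal is nilpotent on every interval. -/
theorem exists_pow_apply_eq_zero {n : FI K X} (hn : ∀ x, n x x = 0) (p q : X) :
    ∃ N, ∀ k, N ≤ k → ∀ x y, p ≤ x → y ≤ q → (n ^ k) x y = 0 := by
  classical
  by_cases hpq : p ≤ q
  swap
  · exact ⟨0, fun k _ x y hx hy => apply_eq_zero _ fun h => hpq (hx.trans (h.trans hy))⟩
  -- A nonzero entry of n^k comes from a strict chain of k steps inside [p, q]. Its k left endpoints
  -- are distinct elements of `T`, so k is at most the size of `T`.
  set T := (n.2 p q hpq).toFinset.image Prod.fst with hT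
  have key : ∀ k x y, p ≤ x → y ≤ q → (n ^ k) x y ≠ 0 →
      ∃ S : Finset X, S ⊆ T ∧ S.card = k ∧ ∀ s ∈ S, x ≤ s := by
    intro k
    induction k with
    | zero => exact fun x y _ _ _ => ⟨∅, by simp, rfl, by simp⟩
    | succ k ih =>
      intro x y hx hy h
      rw [pow_succ'] at h
      obtain ⟨z, hz, hz'⟩ := exists_ne_zero_of_mul_apply_ne_zero h
      have hxz := n.le_of_ne hz
      have hne : x ≠ z := by
        rintro rfl
        exact hz (hn x)
      obtain ⟨S, hS, hc, hle⟩ := ih z y (hx.trans hxz) hy hz'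
      refine ⟨insert x S, ?_, ?_, ?_⟩
      · refine Finset.insert_subset ?_ hS
        rw [hT, Finset.mem_image]
        exact ⟨(x, z), (Set.Finite.mem_toFinset _).2
          ⟨hx, hxz, (le_of_ne _ hz').trans hy, hne, hz⟩, rfl⟩
      · rw [Finset.card_insert_of_notMem fun hmem => hne (le_antisymm hxz (hle x hmem)), hc]
      · intro s hs
        rcases Finset.mem_insert.1 hs with rfl | hs
        · exact le_rfl
        · exact hxz.trans (hle s hs)
  refine ⟨T.card + 1, fun k hk x y hx hy => ?_⟩
  by_contra h
  obtain ⟨S, hS, hc, -⟩ := key k x y hx hy h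
  have := Finset.card_le_card hS
  omega

/-- All positive powers of e equal e, while high powers vanish on any given interval. -/
theorem eq_zero_of_isIdempotentElem {e : FI K X} (he : IsIdempotentElem e)
    (h0 : ∀ x, e x x = 0) : e = 0 := by
  refine ext fun x y _ => ?_
  obtain ⟨N, hN⟩ := exists_pow_apply_eq_zero h0 x y
  have h := hN (N + 1) (Nat.le_succ N) x y le_rfl le_rfl
  rwa [he.pow_succ_eq] at h

/-- An element with unit diagonal is invertible. -/
theorem isUnit_of_apply_self_eq_one {u : FI K X} (hu : ∀ x, u x x = 1) : IsUnit u := by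
  set n : FI K X := 1 - u with hn
  have hn0 : ∀ x, n x x = 0 := fun x => by
    rw [hn, sub_apply, hu, one_apply, if_pos rfl, sub_self]
  have hun : u = 1 - n := by rw [hn, sub_sub_cancel]
  choose N hN using exists_pow_apply_eq_zero hn0
  -- The inverse is the series ∑ n^k, cut off at a length that depends on the interval. The cut-offs
  -- for an interval and for a larger one agree on the smaller.
  have hstable : ∀ p q x y : X, p ≤ x → x ≤ y → y ≤ q →
      (∑ k ∈ Finset.range (N x y), n ^ k) x y = (∑ k ∈ Finset.range (N p q), n ^ k) x y := by
    intro p q x y hx hxy hy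
    have aux : ∀ M, N x y ≤ M → (∑ k ∈ Finset.range (N x y), n ^ k) x y =
        (∑ k ∈ Finset.range M, n ^ k) x y := by
      intro M hM
      rw [sum_apply, sum_apply]
      refine Finset.sum_subset (Finset.range_subset_range.2 hM) fun k _ hk => ?_
      exact hN x y k (by simpa using hk) x y le_rfl le_rfl
    have aux' : ∀ M, N p q ≤ M → (∑ k ∈ Finset.range (N p q), n ^ k) x y =
        (∑ k ∈ Finset.range M, n ^ k) x y := by
      intro M hM
      rw [sum_apply, sum_apply]
      refine Finset.sum_subset (Finset.range_subset_range.2 hM) fun k _ hk => ?_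
      exact hN p q k (by simpa using hk) x y hx hy
    rw [aux _ (le_max_left _ (N p q)), aux' _ (le_max_right (N x y) _)]
  let v : FI K X :=
    ⟨⟨fun x y => (∑ k ∈ Finset.range (N x y), n ^ k) x y, fun x y h => apply_eq_zero _ h⟩, by
      -- Inside [p, q] the function coincides with one finitary element, the sum cut off at `N p q`.
      intro p q hpq
      refine ((∑ k ∈ Finset.range (N p q), n ^ k : FI K X).2 p q hpq).subset ?_
      rintro ⟨x, y⟩ ⟨h1, h2, h3, h4, h5⟩
      refine ⟨h1, h2, h3, h4, fun h => h5 ?_⟩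
      exact (hstable p q x y h1 h2 h3).trans h⟩
  have hv : ∀ p q x y : X, p ≤ x → x ≤ y → y ≤ q →
      v x y = (∑ k ∈ Finset.range (N p q), n ^ k) x y := hstable
  refine isUnit_iff_exists.2 ⟨v, ?_, ?_⟩
  · refine ext fun x y hxy => ?_
    rw [mul_apply_congr (f' := u) (fun z _ _ => rfl)
      (fun z hz hz' => hv x y z y hz hz' le_rfl), hun, mul_neg_geom_sum, sub_apply,
      hN x y _ le_rfl x y le_rfl le_rfl, sub_zero]
  · refine ext fun x y hxy => ?_
    rw [mul_apply_congr (g' := u) (fun z hz hz' => hv x y x z le_rfl hz hz')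
      (fun z _ _ => rfl), hun, geom_sum_mul_neg, sub_apply,
      hN x y _ le_rfl x y le_rfl le_rfl, sub_zero]

/-! ### Action of an automorphism on diagonal entries -/

/-- Apply Φ to e_x f e_x = f(x, x) e_x and compare entries at a diagonal position where the
idempotent Φ(e_x) is nonzero, hence equal to 1. -/
theorem exists_forall_aut_apply (Φ : FI K X ≃ₐ[K] FI K X) (x : X) :
    ∃ y, ∀ f, Φ f y y = f x x := by
  have hid : IsIdempotentElem (Φ (idem K {x})) := by
    rw [IsIdempotentElem, ← map_mul, idem_mul_idem, Set.inter_self]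
  obtain ⟨y, hy⟩ : ∃ y, Φ (idem K {x}) y y ≠ 0 := by
    by_contra! h
    have h0 := eq_zero_of_isIdempotentElem hid h
    rw [map_eq_zero_iff Φ Φ.injective] at h0
    have h1 := idem_apply_of_mem (K := K) (Set.mem_singleton x)
    rw [h0, zero_apply] at h1
    exact zero_ne_one h1
  refine ⟨y, fun f => ?_⟩
  have h := congrArg (fun g => Φ g y y) (idem_mul_mul_idem (le_refl x) f)
  have hh : Φ (idem K {x}) y y * Φ (idem K {x}) y y = Φ (idem K {x}) y y := by
    rw [← mul_apply_self, hid]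
  simp only [map_mul, map_smul, mul_apply_self, smul_apply, matrixUnit_self] at h
  have h1 : Φ (idem K {x}) y y = 1 := mul_left_cancel₀ hy (by rw [hh, mul_one])
  simpa [h1] using h

/-- The functionals f ↦ f(x, x) separate the points of X, so the point maps obtained from Φ and Φ⁻¹
are mutually inverse. -/
theorem exists_equiv_aut_apply (Φ : FI K X ≃ₐ[K] FI K X) :
    ∃ α : X ≃ X, ∀ f x, Φ f (α x) (α x) = f x x := by
  have sep : ∀ x y : X, (∀ f : FI K X, f y y = f x x) → y = x := by
    intro x y h
    by_contra hne
    have h1 := h (idem K {x})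
    rw [idem_apply_of_mem (Set.mem_singleton x), idem_apply_of_notMem (by simpa using hne)] at h1
    exact zero_ne_one h1
  choose α hα using exists_forall_aut_apply Φ
  choose β hβ using exists_forall_aut_apply Φ.symm
  refine ⟨⟨α, β, fun x => sep _ _ fun f => ?_, fun x => sep _ _ fun f => ?_⟩, fun f x => hα x f⟩
  · have h := hβ (α x) (Φ f)
    rwa [Φ.symm_apply_apply, hα] at h
  · have h := hα (β x) (Φ.symm f)
    rwa [Φ.apply_symm_apply, hβ] at h

end FI

/-! ### A combinatorial lemma on fixed-point free maps -/

/-- A fixed-point free map on an infinite set sends some infinite subset to its complement. -/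
theorem Set.Infinite.exists_infinite_subset_image_disjoint {X : Type*} {H : Set X}
    (hH : H.Infinite) (h : X → X) (hne : ∀ x ∈ H, h x ≠ x) :
    ∃ S ⊆ H, S.Infinite ∧ ∀ x ∈ S, h x ∉ S := by
  by_contra! hcon
  have hfin : ∀ S ⊆ H, (∀ x ∈ S, h x ∉ S) → S.Finite := by
    intro S hS hd
    by_contra hinf
    obtain ⟨x, hx, hx'⟩ := hcon S hS hinf
    exact hd x hx hx'
  -- A maximal `M` disjoint from its image is finite by `hfin`. Any point of `H` outside `M`, `h ''
  -- M` and the fibres over `M` could be added to `M`, so these finite sets cover `H`.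
  obtain ⟨M, hM⟩ : ∃ M, Maximal (fun S : Set X => S ⊆ H ∧ ∀ x ∈ S, h x ∉ S) M := by
    refine zorn_subset {S : Set X | S ⊆ H ∧ ∀ x ∈ S, h x ∉ S} fun c hc hch => ?_
    refine ⟨⋃₀ c, ⟨Set.sUnion_subset fun S hS => (hc hS).1, ?_⟩,
      fun S hS => Set.subset_sUnion_of_mem hS⟩
    rintro x ⟨S, hS, hx⟩ ⟨T, hT, hx'⟩
    rcases hch.total hS hT with hST | hTS
    · exact (hc hT).2 x (hST hx) hx'
    · exact (hc hS).2 x hx (hTS hx')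
  have hMfin := hfin M hM.prop.1 hM.prop.2
  -- If x and h x both lay in the fibre over d, then d = h x would be a fixed point in `H`.
  have hfib : ∀ d, (H ∩ h ⁻¹' {d}).Finite := by
    intro d
    refine hfin _ Set.inter_subset_left fun x hx hx' => ?_
    have h1 : h x = d := hx.2
    have h2 : h (h x) = d := hx'.2
    exact hne _ hx'.1 (h2.trans h1.symm)
  refine hH (((hMfin.union (hMfin.image h)).union
    (hMfin.biUnion fun d _ => hfib d)).subset fun x hx => ?_)
  by_contra hx'
  simp only [Set.mem_union, Set.mem_image, Set.mem_iUnion, Set.mem_inter_iff, Set.mem_preimage,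
    Set.mem_singleton_iff, not_or, not_exists, not_and] at hx'
  obtain ⟨⟨h1, h2⟩, h3⟩ := hx'
  refine h1 (hM.le_of_ge (y := insert x M) ⟨Set.insert_subset hx hM.prop.1, ?_⟩
    (Set.subset_insert x M) (Set.mem_insert x M))
  rintro y (rfl | hy) (hy' | hy')
  · exact hne _ hx hy'
  · exact h3 _ hy' hx rfl
  · exact h2 y hy hy'
  · exact hM.prop.2 y hy hy'

/-! ### Simultaneous conjugation of the idempotents -/

namespace FI

variable {K X : Type*} [Field K] [PartialOrder X]

/-- Only finitely many points of an interval are tails of nonzero entries in the distinguished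
columns of the images of the primitive diagonal idempotents. -/
theorem finite_column_tails (Φ : FI K X ≃ₐ[K] FI K X) {α : X ≃ X}
    (hα : ∀ f x, Φ f (α x) (α x) = f x x) {p q : X} (hpq : p ≤ q) :
    {c | ∃ x, p ≤ c ∧ c ≠ α x ∧ α x ≤ q ∧ Φ (idem K {x}) c (α x) ≠ 0}.Finite := by
  by_contra hinf
  choose! t ht using fun (c : X) (hc : c ∈ {c | ∃ x, p ≤ c ∧ c ≠ α x ∧ α x ≤ q ∧
    Φ (idem K {x}) c (α x) ≠ 0}) => hc
  obtain ⟨S, hSH, hS, hd⟩ := Set.Infinite.exists_infinite_subset_image_disjoint hinf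
    (fun c => α (t c)) fun c hc => (ht c hc).2.1.symm
  -- This single element satisfies G E_{t c} = E_{t c} for all c in `S`, yet has zero diagonal on
  -- `S`. Every c in `S` thus starts a nontrivial nonzero entry of `G` in [p, q], contradicting
  -- finitarity.
  set G := Φ (idem K (α ⁻¹' Sᶜ)) with hG
  refine hS (((G.2 p q hpq).image Prod.fst).subset fun c hc => ?_)
  obtain ⟨h1, h2, h3, h4⟩ := ht c (hSH hc)
  have hGE : G * Φ (idem K {t c}) = Φ (idem K {t c}) := by
    rw [hG, ← map_mul, idem_mul_idem, Set.inter_eq_right.2]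
    rintro _ rfl
    exact hd c hc
  rw [← hGE] at h4
  obtain ⟨z, hz, hz'⟩ := exists_ne_zero_of_mul_apply_ne_zero h4
  refine ⟨(c, z), ⟨h1, le_of_ne _ hz, (le_of_ne _ hz').trans h3, fun hcz => ?_, hz⟩, rfl⟩
  obtain rfl : c = z := hcz
  have h := hα (idem K (α ⁻¹' Sᶜ)) (α.symm c)
  rw [α.apply_symm_apply, idem_apply_of_notMem (by simpa using hc)] at h
  exact hz h

/-- This is the finitarity of the conjugating matrix in `exists_unit_conj_idem`. Each row has
finitely many entries in [p, q], and a minimal off-diagonal entry of a row forces a column tail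
there, so only finitely many rows matter. -/
theorem finite_row_support (Φ : FI K X ≃ₐ[K] FI K X) {α : X ≃ X}
    (hα : ∀ f x, Φ f (α x) (α x) = f x x) {p q : X} (hpq : p ≤ q) :
    {e : X × X | p ≤ e.1 ∧ e.1 ≤ e.2 ∧ e.2 ≤ q ∧ e.1 ≠ e.2 ∧
      Φ (idem K {α.symm e.1}) e.1 e.2 ≠ 0}.Finite := by
  have hone : ∀ x, Φ (idem K {x}) (α x) (α x) = 1 := fun x => by
    rw [hα, idem_apply_of_mem (Set.mem_singleton x)]
  have hrow : ∀ a, p ≤ a → {b | b ≤ q ∧ a ≠ b ∧ Φ (idem K {α.symm a}) a b ≠ 0}.Finite := by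
    intro a ha
    refine (((Φ (idem K {α.symm a})).2 p q hpq).image Prod.snd).subset ?_
    rintro b ⟨h1, h2, h3⟩
    exact ⟨(a, b), ⟨ha, le_of_ne _ h3, h1, h2, h3⟩, rfl⟩
  set T := {c | ∃ x, p ≤ c ∧ c ≠ α x ∧ α x ≤ q ∧ Φ (idem K {x}) c (α x) ≠ 0} with hT
  have hTfin : T.Finite := finite_column_tails Φ hα hpq
  have htail : ∀ a b, p ≤ a → b ≤ q → a ≠ b → Φ (idem K {α.symm a}) a b ≠ 0 → a ∈ T := by
    intro a b₀ ha hb₀ hne₀ h₀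
    obtain ⟨b, hb⟩ := (hrow a ha).exists_minimal ⟨b₀, hb₀, hne₀, h₀⟩
    obtain ⟨⟨hbq, hab, hEab⟩, hmin⟩ := hb
    refine ⟨α.symm b, ha, by simpa using hab, by simpa using hbq, ?_⟩
    rw [α.apply_symm_apply]
    -- By minimality of `b`, the (a, b) entry of the zero product below has only the terms z = a and
    -- z = b. If the first vanishes, so does the second, which is the nonzero entry at (a, b) times
    -- 1.
    intro hzero
    have hprod : Φ (idem K {α.symm a}) * Φ (idem K {α.symm b}) = 0 := by
      rw [← map_mul, idem_mul_idem, Set.singleton_inter_eq_empty.2 (by simpa using hab),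
        idem_empty, map_zero]
    have h := congrArg (fun f : FI K X => f a b) hprod
    simp only [zero_apply] at h
    rw [mul_apply_eq_sum _ _ a b {b} ?_, Finset.sum_singleton] at h
    · have h1 := hone (α.symm b)
      rw [α.apply_symm_apply] at h1
      rw [h1, mul_one] at h
      exact hEab h
    · intro z hz hz'
      rw [Finset.mem_singleton]
      have hzb := le_of_ne _ hz'
      by_cases haz : a = z
      · subst haz
        exact absurd hzero hz'
      · exact le_antisymm hzb (hmin ⟨hzb.trans hbq, haz, hz⟩ hzb)
  classical
  refine ((hTfin.inter_of_left {a | p ≤ a}).biUnion (t := fun a =>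
    Prod.mk a '' {b | b ≤ q ∧ a ≠ b ∧ Φ (idem K {α.symm a}) a b ≠ 0})
    fun a ha => (hrow a ha.2).image _).subset ?_
  rintro ⟨a, b⟩ ⟨h1, h2, h3, h4, h5⟩
  simp only [Set.mem_iUnion]
  exact ⟨a, ⟨htail a b h1 h3 h4 h5, h1⟩, b, ⟨h3, h4, h5⟩, rfl⟩

/-- The images of the primitive diagonal idempotents are simultaneously conjugate to primitive
diagonal idempotents. -/
theorem exists_unit_conj_idem (Φ : FI K X ≃ₐ[K] FI K X) {α : X ≃ X}
    (hα : ∀ f x, Φ f (α x) (α x) = f x x) :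
    ∃ u : (FI K X)ˣ, ∀ x, u * Φ (idem K {x}) * (↑u⁻¹ : FI K X) = idem K {α x} := by
  let v : FI K X :=
    ⟨⟨fun a b => Φ (idem K {α.symm a}) a b, fun x y h => apply_eq_zero _ h⟩,
      fun p q hpq => finite_row_support Φ hα hpq⟩
  have hv : ∀ a b, v a b = Φ (idem K {α.symm a}) a b := fun _ _ => rfl
  obtain ⟨u, hu⟩ : IsUnit v := isUnit_of_apply_self_eq_one fun a => by
    have h := hα (idem K {α.symm a}) (α.symm a)
    rwa [α.apply_symm_apply, idem_apply_of_mem (Set.mem_singleton _)] at h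
  refine ⟨u, fun x => ?_⟩
  rw [Units.mul_inv_eq_iff_eq_mul, hu]
  refine ext fun a b _ => ?_
  -- Only row a of the left factor enters, so `v` may be replaced by the idempotent providing that
  -- row. The product is then the image of a product of two diagonal idempotents.
  rw [mul_apply_congr (f := v) (f' := Φ (idem K {α.symm a})) (g' := Φ (idem K {x})) (fun _ _ _ => rfl)
    (fun _ _ _ => rfl), ← map_mul, idem_mul_idem]
  by_cases ha : a = α x
  · subst ha
    rw [idem_mul_apply_self, hv, α.symm_apply_apply, Set.inter_self]
  · rw [idem_mul_apply_ne ha, Set.singleton_inter_eq_empty.2, idem_empty, map_zero, zero_apply]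
    rw [Set.mem_singleton_iff, α.symm_apply_eq]
    exact ha

/-! ### Decomposition of automorphisms -/

/-- An automorphism permuting the primitive diagonal idempotents is the composition of a
multiplicative automorphism and one induced by an automorphism of the poset. -/
theorem exists_multAut_hat (Φ : FI K X ≃ₐ[K] FI K X) (α : X ≃ X)
    (hΦ : ∀ x, Φ (idem K {x}) = idem K {α x}) :
    ∃ (β : X ≃o X) (M : FI K X ≃ₐ[K] FI K X), IsMultiplicativeAut M ∧
      ∀ f, Φ f = M (hat (K := K) β f) := by
  have hconj : ∀ f x y, Φ f (α x) (α y) = Φ (idem K {x} * f * idem K {y}) (α x) (α y) := by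
    intro f x y
    rw [map_mul, map_mul, hΦ, hΦ, mul_idem_apply_self, idem_mul_apply_self]
  have hle : ∀ {x y} (h : x ≤ y) f,
      Φ f (α x) (α y) = f x y * Φ (matrixUnit K h) (α x) (α y) := by
    intro x y h f
    rw [hconj, idem_mul_mul_idem h, map_smul, smul_apply]
  have hnle : ∀ {x y}, ¬ x ≤ y → ∀ f, Φ f (α x) (α y) = 0 := by
    intro x y h f
    rw [hconj, idem_mul_mul_idem_of_not_le h, map_zero, zero_apply]
  have hsupp : ∀ {x y} (h : x ≤ y) a b, ¬ (a = α x ∧ b = α y) → Φ (matrixUnit K h) a b = 0 := by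
    intro x y h a b hab
    obtain ⟨a, rfl⟩ := α.surjective a
    obtain ⟨b, rfl⟩ := α.surjective b
    by_cases h' : a ≤ b
    · rw [hle h', matrixUnit_apply_ne h fun e => hab (by rw [e.1, e.2]; exact ⟨rfl, rfl⟩),
        zero_mul]
    · exact hnle h' _
  have hσ : ∀ {x y} (h : x ≤ y), Φ (matrixUnit K h) (α x) (α y) ≠ 0 := by
    intro x y h h0
    have h1 : Φ (matrixUnit K h) = 0 := by
      refine ext fun a b _ => ?_
      by_cases hab : a = α x ∧ b = α y
      · rw [hab.1, hab.2, h0, zero_apply]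
      · exact hsupp h a b hab
    rw [map_eq_zero_iff Φ Φ.injective] at h1
    have h2 := matrixUnit_apply_self (K := K) h
    rw [h1, zero_apply] at h2
    exact zero_ne_one h2
  let β : X ≃o X := ⟨α, fun {x y} => by
    constructor
    · intro h
      by_contra h'
      -- The matrix unit at (αx, αy) exists and lies in the range of Φ, but every value of Φ
      -- vanishes at that position.
      have h1 := hnle h' (Φ.symm (matrixUnit K h))
      rw [Φ.apply_symm_apply, matrixUnit_apply_self] at h1
      exact one_ne_zero h1
    · intro h
      exact le_of_ne _ (hσ h)⟩
  have hβ : ∀ x, β x = α x := fun _ => rfl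
  have hβs : ∀ x, β.symm x = α.symm x := fun _ => rfl
  classical
  -- The value at (αx, αy) is the scalar relating Φ of the matrix unit at (x, y) to the matrix unit
  -- at (αx, αy).
  let σ : IncidenceAlgebra K X :=
    ⟨fun a b => if h : β.symm a ≤ β.symm b then Φ (matrixUnit K h) a b else 0,
      fun a b h => dif_neg fun h' => h (β.symm.le_iff_le.1 h')⟩
  have hσa : ∀ {x y} (h : x ≤ y), σ (α x) (α y) = Φ (matrixUnit K h) (α x) (α y) := by
    intro x y h
    change (if h : β.symm (β x) ≤ β.symm (β y) then Φ (matrixUnit K h) (α x) (α y) else 0) = _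
    simp only [OrderIso.symm_apply_apply]
    exact dif_pos h
  have hmult : IsMultiplicativeElement σ := by
    constructor
    · intro a b hab
      obtain ⟨x, rfl⟩ := β.surjective a
      obtain ⟨y, rfl⟩ := β.surjective b
      have h := β.le_iff_le.1 hab
      rw [hβ, hβ, hσa h]
      exact hσ h
    · intro a b c hab hbc
      obtain ⟨x, rfl⟩ := β.surjective a
      obtain ⟨y, rfl⟩ := β.surjective b
      obtain ⟨z, rfl⟩ := β.surjective c
      have h := β.le_iff_le.1 hab
      have h' := β.le_iff_le.1 hbc
      rw [hβ, hβ, hβ, hσa h, hσa h', hσa (h.trans h'), ← matrixUnit_mul h h', map_mul,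
        mul_apply_eq_sum _ _ _ _ {α y}, Finset.sum_singleton]
      intro w hw _
      rw [Finset.mem_singleton]
      by_contra hne
      exact hw (hsupp h _ _ fun e => hne e.2)
  refine ⟨β, multAut σ hmult, ⟨σ, hmult, rfl⟩, fun f => ext fun a b hab => ?_⟩
  obtain ⟨x, rfl⟩ := β.surjective a
  obtain ⟨y, rfl⟩ := β.surjective b
  have h := β.le_iff_le.1 hab
  rw [multAut_apply, hat_apply, β.symm_apply_apply, β.symm_apply_apply, hβ, hβ, hσa h, hle h,
    mul_comm]

/-- Conjugation by a unit. -/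
noncomputable def conj (u : (FI K X)ˣ) : FI K X ≃ₐ[K] FI K X :=
  AlgEquiv.ofAlgHom
    (AlgHom.ofLinearMap (LinearMap.mulLeft K (u : FI K X) ∘ₗ LinearMap.mulRight K (↑u⁻¹ : FI K X))
      (by simp) (by intro a b; simp [mul_assoc]))
    (AlgHom.ofLinearMap (LinearMap.mulLeft K (↑u⁻¹ : FI K X) ∘ₗ LinearMap.mulRight K (u : FI K X))
      (by simp) (by intro a b; simp [mul_assoc]))
    (by ext1 a; simp [mul_assoc]) (by ext1 a; simp [mul_assoc])

theorem conj_apply (u : (FI K X)ˣ) (a : FI K X) : conj u a = u * a * (↑u⁻¹ : FI K X) := by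
  simp [conj, mul_assoc]

/-- Every automorphism is the composition of an inner one, a multiplicative one and one induced
by an automorphism of the poset. -/
theorem exists_inner_multAut_hat (Φ : FI K X ≃ₐ[K] FI K X) :
    ∃ (α : X ≃o X) (M : FI K X ≃ₐ[K] FI K X) (u : (FI K X)ˣ), IsMultiplicativeAut M ∧
      ∀ f, Φ f = u * M (hat (K := K) α f) * (↑u⁻¹ : FI K X) := by
  obtain ⟨α, hα⟩ := exists_equiv_aut_apply Φ
  obtain ⟨u, hu⟩ := exists_unit_conj_idem Φ hα
  obtain ⟨β, M, hM, h⟩ := exists_multAut_hat (Φ.trans (conj u)) α fun x => by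
    rw [AlgEquiv.trans_apply, conj_apply, hu]
  refine ⟨β, M, u⁻¹, hM, fun f => ?_⟩
  rw [← h, AlgEquiv.trans_apply, conj_apply]
  simp [mul_assoc]

end FI

/-! ### Classification of involutions -/

theorem theorem4p1 {K X : Type*} [Field K] [PartialOrder X]
    (hK : ringChar K ≠ 2) (hX : PosetConnected X)
    (hM : ∀ M : FI K X ≃ₐ[K] FI K X, FI.IsMultiplicativeAut M → IsInnerAut M)
    (ρ₁ ρ₂ : FI K X → FI K X)
    (h₁ : IsInvolutionSecondKind ρ₁) (h₂ : IsInvolutionSecondKind ρ₂) :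
    InvolutionsEquivalent K ρ₁ ρ₂ ↔
      ∃ (α : X ≃o X) (Ψ : FI K X ≃ₐ[K] FI K X), IsInnerAut Ψ ∧
        ρ₁ = ⇑Ψ ∘ ⇑(FI.hat (K := K) α) ∘ ρ₂ ∘ ⇑(FI.hat (K := K) α).symm ∘ ⇑Ψ.symm := by
  constructor
  · rintro ⟨Φ, hΦ⟩
    -- The inverse of Φ is decomposed because ρ₁ = Φ⁻¹ ∘ ρ₂ ∘ Φ needs Ψ ∘ α̂ on the left.
    obtain ⟨α, M, u, hMm, hdec⟩ := FI.exists_inner_multAut_hat Φ.symm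
    obtain ⟨w, hw⟩ := hM M hMm
    have hfac : ∀ f, Φ.symm f = FI.conj (u * w) (FI.hat (K := K) α f) := fun f => by
      rw [hdec, hw, FI.conj_apply]
      simp [mul_assoc]
    refine ⟨α, FI.conj (u * w), ⟨u * w, FI.conj_apply _⟩, funext fun f => ?_⟩
    have h1 : Φ f = (FI.hat (K := K) α).symm ((FI.conj (u * w)).symm f) := by
      rw [AlgEquiv.eq_symm_apply, AlgEquiv.eq_symm_apply, ← hfac, AlgEquiv.symm_apply_apply]
    have h2 := congrFun hΦ f
    simp only [Function.comp_apply] at h2 ⊢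
    rw [← hfac, ← h1, ← h2, AlgEquiv.symm_apply_apply]
  · rintro ⟨α, Ψ, -, h⟩
    refine ⟨Ψ.symm.trans (FI.hat (K := K) α).symm, funext fun f => ?_⟩
    have h1 := congrFun h f
    simp only [Function.comp_apply] at h1
    simp only [Function.comp_apply, AlgEquiv.trans_apply]
    rw [h1, AlgEquiv.symm_apply_apply, AlgEquiv.symm_apply_apply]
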